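/- **Biquandles.** A biquandle is a set with four binary operations, written here $a^{b}$, $a_{b}$, $a^{\bar b}$, $a_{\bar b}$ (operations associate to the left), such that for all elements $a,b,c$: (1) there is $x$ with $(a^{x})_{a}=a$; (2) there is $x$ with $x=a_{\bar x}$ and $a=x^{\bar a}$; (3) $a=(a_{b})_{\overline{b^{a}}}=(a^{b})^{\overline{b_{a}}}=(a^{\bar b})^{\,b_{\bar a}}=(a_{\bar b})_{\,b^{\bar a}}$; (4) there is $x$ with $x=a^{\,b_{\bar x}}$, $a=x^{\bar b}$ and $b=(b_{\bar x})_{a}$; (5) $(a^{b})^{c}=(a^{c_{b}})^{b^{c}}$, $\;(a_{b})_{c}=(a_{c^{b}})_{b_{c}}$, $\;(a_{b})^{c_{(b^{a})}}=(a^{c})_{b^{(c_{a})}}$; together with the variants of (1), (2), (4), (5) in which each operation is exchanged with its barred counterpart. **Diagrams.** An oriented virtual knot diagram $K$ (with any number of components) is a generic smooth immersion of finitely many oriented circles in $\mathbb R^2$, with finitely many double points, all of them transverse, and no triple points, where each double point is labelled either as a real crossing (with an over and an under strand) or as a virtual crossing. Its arcs run from one real crossing to the next, over or under, passing through virtual crossings;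 a component without real crossings is one arc. **The biquandle of a diagram.** Each real crossing gives two relations. Let $o,u$ be the incoming and $o',u'$ the outgoing arcs of its over and under strand. At a positive crossing (one where the directions of the over and the under strand, in this order, form a positively oriented basis of the plane) the relations are $o'=o_{u}$ and $u'=u^{o}$. At a negative crossing they are $o'=o_{\bar u}$ and $u'=u^{\bar o}$. A biquandle $A$ is called *a biquandle for $K$* if it is generated, under the four operations, by elements indexed by the arcs of $K$ that satisfy these relations. $BQ(K)$ denotes the biquandle presented by the arcs as generators and these relations: expressions are formed with the four operations and one further operation for each element whose existence axioms (1), (2), (4) and their variants assert, and they are taken modulo the congruence generated by the axioms and the relations. **Vertical mirror image.** $K^\uparrow$ is obtained from $K$ by reflecting the plane in a vertical line, keeping over strands over and virtual crossings virtual, and reversing the orientation of all components. (So the vertical mirror image of the closure of a virtual braid $\beta$ is the closure of $\beta^{-1}$.) **Corollary.** For every oriented virtual knot diagram $K$ we have $BQ(K)\cong BQ(K^\uparrow)$ as biquandles. Moreover, a biquandle is a biquandle for $K$ if and only if it is a biquandle for $K^\uparrow$. -/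

import Mathlib

open scoped ContDiff Topology
open Filter

/-! ### Biquandles -/

/-- Four binary operations, named after the position of the operator bar:
`ur a b` is `a` with the upper right bar over `b`, `lr` lower right, `ul` upper left,
`ll` lower left. -/
class BiquandleOps (A : Type*) where
  ur : A → A → A
  lr : A → A → A
  ul : A → A → A
  ll : A → A → A

open BiquandleOps in
/-- A biquandle. A name ending in `_var` is the left/right variant (exchange `ur` with `ul` and
`lr` with `ll`) of the axiom before it. -/
class Biquandle (A : Type*) extends BiquandleOps A where
  ax1 : ∀ a : A, ∃ x : A, lr (ur a x) a = a
  ax1_var : ∀ a : A, ∃ x : A, ll (ul a x) a = a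
  ax2 : ∀ a : A, ∃ x : A, x = ll a x ∧ a = ul x a
  ax2_var : ∀ a : A, ∃ x : A, x = lr a x ∧ a = ur x a
  ax3_lr : ∀ a b : A, a = ll (lr a b) (ur b a)
  ax3_ur : ∀ a b : A, a = ul (ur a b) (lr b a)
  ax3_ul : ∀ a b : A, a = ur (ul a b) (ll b a)
  ax3_ll : ∀ a b : A, a = lr (ll a b) (ul b a)
  ax4 : ∀ a b : A, ∃ x : A, x = ur a (ll b x) ∧ a = ul x b ∧ b = lr (ll b x) a
  ax4_var : ∀ a b : A, ∃ x : A, x = ul a (lr b x) ∧ a = ur x b ∧ b = ll (lr b x) a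
  ax5_ur : ∀ a b c : A, ur (ur a b) c = ur (ur a (lr c b)) (ur b c)
  ax5_ur_var : ∀ a b c : A, ul (ul a b) c = ul (ul a (ll c b)) (ul b c)
  ax5_lr : ∀ a b c : A, lr (lr a b) c = lr (lr a (ur c b)) (lr b c)
  ax5_lr_var : ∀ a b c : A, ll (ll a b) c = ll (ll a (ul c b)) (ll b c)
  ax5_mix : ∀ a b c : A, ur (lr a b) (lr c (ur b a)) = lr (ur a c) (ur b (lr c a))
  ax5_mix_var : ∀ a b c : A, ul (ll a b) (ll c (ul b a)) = ll (ul a c) (ul b (ll c a))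

open BiquandleOps in
/-- An isomorphism of biquandles: a bijection that respects the four operations. -/
structure BiquandleIso (A B : Type*) [Biquandle A] [Biquandle B] extends A ≃ B where
  map_ur : ∀ a b, toFun (ur a b) = ur (toFun a) (toFun b)
  map_lr : ∀ a b, toFun (lr a b) = lr (toFun a) (toFun b)
  map_ul : ∀ a b, toFun (ul a b) = ul (toFun a) (toFun b)
  map_ll : ∀ a b, toFun (ll a b) = ll (toFun a) (toFun b)

/-! ### Generators and relations -/

/-- Formal expressions in generators `α` and the four operations. -/
inductive BWord (α : Type*) where
  | gen : α → BWord α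
  | ur : BWord α → BWord α → BWord α
  | lr : BWord α → BWord α → BWord α
  | ul : BWord α → BWord α → BWord α
  | ll : BWord α → BWord α → BWord α

/-- Value of an expression when the generators are given the values `g`. -/
def BWord.eval {α A : Type*} [BiquandleOps A] (g : α → A) : BWord α → A
  | .gen a => g a
  | .ur s t => BiquandleOps.ur (s.eval g) (t.eval g)
  | .lr s t => BiquandleOps.lr (s.eval g) (t.eval g)
  | .ul s t => BiquandleOps.ul (s.eval g) (t.eval g)
  | .ll s t => BiquandleOps.ll (s.eval g) (t.eval g)

/-- Expressions in the generators, the four operations, and one operation for each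
element whose existence a biquandle axiom asserts. -/
inductive BTerm (α : Type*) where
  | gen : α → BTerm α
  | ur : BTerm α → BTerm α → BTerm α
  | lr : BTerm α → BTerm α → BTerm α
  | ul : BTerm α → BTerm α → BTerm α
  | ll : BTerm α → BTerm α → BTerm α
  | x1 : BTerm α → BTerm α
  | x1v : BTerm α → BTerm α
  | x2 : BTerm α → BTerm α
  | x2v : BTerm α → BTerm α
  | x4 : BTerm α → BTerm α → BTerm α
  | x4v : BTerm α → BTerm α → BTerm α

instance BTerm.instOps {α : Type*} : BiquandleOps (BTerm α) := ⟨.ur, .lr, .ul, .ll⟩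

/-- The congruence on terms generated by the biquandle axioms and the relations `r`. -/
inductive BTerm.Rel {α : Type*} (r : BWord α → BWord α → Prop) : BTerm α → BTerm α → Prop
  | refl (a) : Rel r a a
  | symm {a b} : Rel r a b → Rel r b a
  | trans {a b c} : Rel r a b → Rel r b c → Rel r a c
  | congr_ur {a a' b b'} : Rel r a a' → Rel r b b' → Rel r (.ur a b) (.ur a' b')
  | congr_lr {a a' b b'} : Rel r a a' → Rel r b b' → Rel r (.lr a b) (.lr a' b')
  | congr_ul {a a' b b'} : Rel r a a' → Rel r b b' → Rel r (.ul a b) (.ul a' b')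
  | congr_ll {a a' b b'} : Rel r a a' → Rel r b b' → Rel r (.ll a b) (.ll a' b')
  | congr_x1 {a a'} : Rel r a a' → Rel r (.x1 a) (.x1 a')
  | congr_x1v {a a'} : Rel r a a' → Rel r (.x1v a) (.x1v a')
  | congr_x2 {a a'} : Rel r a a' → Rel r (.x2 a) (.x2 a')
  | congr_x2v {a a'} : Rel r a a' → Rel r (.x2v a) (.x2v a')
  | congr_x4 {a a' b b'} : Rel r a a' → Rel r b b' → Rel r (.x4 a b) (.x4 a' b')
  | congr_x4v {a a' b b'} : Rel r a a' → Rel r b b' → Rel r (.x4v a b) (.x4v a' b')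
  | rel {s t : BWord α} : r s t → Rel r (s.eval BTerm.gen) (t.eval BTerm.gen)
  | ax1 (a) : Rel r (.lr (.ur a (.x1 a)) a) a
  | ax1_var (a) : Rel r (.ll (.ul a (.x1v a)) a) a
  | ax2_l (a) : Rel r (.x2 a) (.ll a (.x2 a))
  | ax2_r (a) : Rel r a (.ul (.x2 a) a)
  | ax2_var_l (a) : Rel r (.x2v a) (.lr a (.x2v a))
  | ax2_var_r (a) : Rel r a (.ur (.x2v a) a)
  | ax3_lr (a b) : Rel r a (.ll (.lr a b) (.ur b a))
  | ax3_ur (a b) : Rel r a (.ul (.ur a b) (.lr b a))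
  | ax3_ul (a b) : Rel r a (.ur (.ul a b) (.ll b a))
  | ax3_ll (a b) : Rel r a (.lr (.ll a b) (.ul b a))
  | ax4_x (a b) : Rel r (.x4 a b) (.ur a (.ll b (.x4 a b)))
  | ax4_a (a b) : Rel r a (.ul (.x4 a b) b)
  | ax4_b (a b) : Rel r b (.lr (.ll b (.x4 a b)) a)
  | ax4_var_x (a b) : Rel r (.x4v a b) (.ul a (.lr b (.x4v a b)))
  | ax4_var_a (a b) : Rel r a (.ur (.x4v a b) b)
  | ax4_var_b (a b) : Rel r b (.ll (.lr b (.x4v a b)) a)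
  | ax5_ur (a b c) : Rel r (.ur (.ur a b) c) (.ur (.ur a (.lr c b)) (.ur b c))
  | ax5_ur_var (a b c) : Rel r (.ul (.ul a b) c) (.ul (.ul a (.ll c b)) (.ul b c))
  | ax5_lr (a b c) : Rel r (.lr (.lr a b) c) (.lr (.lr a (.ur c b)) (.lr b c))
  | ax5_lr_var (a b c) : Rel r (.ll (.ll a b) c) (.ll (.ll a (.ul c b)) (.ll b c))
  | ax5_mix (a b c) :
      Rel r (.ur (.lr a b) (.lr c (.ur b a))) (.lr (.ur a c) (.ur b (.lr c a)))
  | ax5_mix_var (a b c) :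
      Rel r (.ul (.ll a b) (.ll c (.ul b a))) (.ll (.ul a c) (.ul b (.ll c a)))

def BTerm.setoid {α : Type*} (r : BWord α → BWord α → Prop) : Setoid (BTerm α) :=
  ⟨BTerm.Rel r, .refl, .symm, .trans⟩

/-- The biquandle with generators `α` and relations `r`. -/
def PresentedBiquandle {α : Type*} (r : BWord α → BWord α → Prop) : Type _ :=
  Quotient (BTerm.setoid r)

instance PresentedBiquandle.instBiquandle {α : Type*} (r : BWord α → BWord α → Prop) :
    Biquandle (PresentedBiquandle r) where
  ur := Quotient.map₂ BTerm.ur fun _ _ h _ _ k => .congr_ur h k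
  lr := Quotient.map₂ BTerm.lr fun _ _ h _ _ k => .congr_lr h k
  ul := Quotient.map₂ BTerm.ul fun _ _ h _ _ k => .congr_ul h k
  ll := Quotient.map₂ BTerm.ll fun _ _ h _ _ k => .congr_ll h k
  ax1 := by
    rintro ⟨a⟩; exact ⟨Quotient.mk _ (.x1 a), Quotient.sound (.ax1 a)⟩
  ax1_var := by
    rintro ⟨a⟩; exact ⟨Quotient.mk _ (.x1v a), Quotient.sound (.ax1_var a)⟩
  ax2 := by
    rintro ⟨a⟩
    exact ⟨Quotient.mk _ (.x2 a), Quotient.sound (.ax2_l a), Quotient.sound (.ax2_r a)⟩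
  ax2_var := by
    rintro ⟨a⟩
    exact ⟨Quotient.mk _ (.x2v a), Quotient.sound (.ax2_var_l a), Quotient.sound (.ax2_var_r a)⟩
  ax3_lr := by rintro ⟨a⟩ ⟨b⟩; exact Quotient.sound (.ax3_lr a b)
  ax3_ur := by rintro ⟨a⟩ ⟨b⟩; exact Quotient.sound (.ax3_ur a b)
  ax3_ul := by rintro ⟨a⟩ ⟨b⟩; exact Quotient.sound (.ax3_ul a b)
  ax3_ll := by rintro ⟨a⟩ ⟨b⟩; exact Quotient.sound (.ax3_ll a b)
  ax4 := by
    rintro ⟨a⟩ ⟨b⟩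
    exact ⟨Quotient.mk _ (.x4 a b), Quotient.sound (.ax4_x a b), Quotient.sound (.ax4_a a b),
      Quotient.sound (.ax4_b a b)⟩
  ax4_var := by
    rintro ⟨a⟩ ⟨b⟩
    exact ⟨Quotient.mk _ (.x4v a b), Quotient.sound (.ax4_var_x a b),
      Quotient.sound (.ax4_var_a a b), Quotient.sound (.ax4_var_b a b)⟩
  ax5_ur := by rintro ⟨a⟩ ⟨b⟩ ⟨c⟩; exact Quotient.sound (.ax5_ur a b c)
  ax5_ur_var := by rintro ⟨a⟩ ⟨b⟩ ⟨c⟩; exact Quotient.sound (.ax5_ur_var a b c)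
  ax5_lr := by rintro ⟨a⟩ ⟨b⟩ ⟨c⟩; exact Quotient.sound (.ax5_lr a b c)
  ax5_lr_var := by rintro ⟨a⟩ ⟨b⟩ ⟨c⟩; exact Quotient.sound (.ax5_lr_var a b c)
  ax5_mix := by rintro ⟨a⟩ ⟨b⟩ ⟨c⟩; exact Quotient.sound (.ax5_mix a b c)
  ax5_mix_var := by rintro ⟨a⟩ ⟨b⟩ ⟨c⟩; exact Quotient.sound (.ax5_mix_var a b c)

/-! ### Virtual knot diagrams -/

/-- A disjoint union of `n` oriented circles. -/
abbrev Circles (n : ℕ) : Type := Fin n × UnitAddCircle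

/-- The point reached from `p` by moving `s` along its circle. -/
def Circles.move {n : ℕ} (p : Circles n) (s : ℝ) : Circles n := (p.1, p.2 + (s : UnitAddCircle))

/-- Velocity at `p` of a map from the circles to the plane. -/
noncomputable def Circles.velocity {n : ℕ} (γ : Circles n → ℝ × ℝ) (p : Circles n) : ℝ × ℝ :=
  deriv (fun s : ℝ => γ (p.move s)) 0

def planeDet (v w : ℝ × ℝ) : ℝ := v.1 * w.2 - v.2 * w.1

/-- An oriented virtual knot (or link) diagram with `n` components: a generic smooth immersion of
`n` oriented circles in the plane, every double point of which is labelled as a real crossing, with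
one strand over the other, or as a virtual crossing. -/
structure VirtualKnotDiagram (n : ℕ) where
  toFun : Circles n → ℝ × ℝ
  smooth : ∀ p : Circles n, ContDiff ℝ ∞ fun s : ℝ => toFun (p.move s)
  immersion : ∀ p, Circles.velocity toFun p ≠ 0
  finite_double : {x : Circles n × Circles n | x.1 ≠ x.2 ∧ toFun x.1 = toFun x.2}.Finite
  no_triple : ∀ p q r, p ≠ q → q ≠ r → p ≠ r → toFun p = toFun q → toFun q ≠ toFun r
  transverse : ∀ p q, p ≠ q → toFun p = toFun q →
    planeDet (Circles.velocity toFun p) (Circles.velocity toFun q) ≠ 0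
  /-- `IsOver p q`: the strands at `p` and `q` meet in a real crossing, and `p` lies on the over
  strand. A double point `{p, q}` with neither `IsOver p q` nor `IsOver q p` is virtual. -/
  IsOver : Circles n → Circles n → Prop
  isOver_double : ∀ p q, IsOver p q → p ≠ q ∧ toFun p = toFun q
  isOver_asymm : ∀ p q, IsOver p q → ¬ IsOver q p

namespace VirtualKnotDiagram

variable {n : ℕ}

/-- The points of the circles that lie at a real crossing. -/
def realPoints (K : VirtualKnotDiagram n) : Set (Circles n) :=
  {p | ∃ q, K.IsOver p q ∨ K.IsOver q p}

/-- The arcs of a diagram run from one real crossing to the next (over or under), through virtual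
crossings; a circle without real crossings is one arc. -/
def Arc (K : VirtualKnotDiagram n) : Type :=
  ConnectedComponents {p : Circles n // p ∉ K.realPoints}

/-- The arc `a` enters `p`. -/
def IsIn (K : VirtualKnotDiagram n) (p : Circles n) (a : K.Arc) : Prop :=
  ∀ᶠ s : ℝ in 𝓝[>] 0, ∃ h : p.move (-s) ∉ K.realPoints, ConnectedComponents.mk ⟨_, h⟩ = a

/-- The arc `a` leaves `p`. -/
def IsOut (K : VirtualKnotDiagram n) (p : Circles n) (a : K.Arc) : Prop :=
  ∀ᶠ s : ℝ in 𝓝[>] 0, ∃ h : p.move s ∉ K.realPoints, ConnectedComponents.mk ⟨_, h⟩ = a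

/-- At the real crossing with over strand through `p` and under strand through `q`, the over strand
comes in along the arc `o` and goes out along `o'`, the under strand in along `u` and out along
`u'`. -/
def CrossingArcs (K : VirtualKnotDiagram n) (p q : Circles n) (o o' u u' : K.Arc) : Prop :=
  K.IsOver p q ∧ K.IsIn p o ∧ K.IsOut p o' ∧ K.IsIn q u ∧ K.IsOut q u'

/-- Orientation of the frame (over strand, under strand): positive at a positive crossing. -/
noncomputable def crossingDet (K : VirtualKnotDiagram n) (p q : Circles n) : ℝ :=
  planeDet (Circles.velocity K.toFun p) (Circles.velocity K.toFun q)

/-- The two relations of each real crossing. -/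
inductive CrossingRel (K : VirtualKnotDiagram n) : BWord K.Arc → BWord K.Arc → Prop
  | pos_over {p q o o' u u'} : K.CrossingArcs p q o o' u u' → 0 < K.crossingDet p q →
      CrossingRel K (.gen o') (.lr (.gen o) (.gen u))
  | pos_under {p q o o' u u'} : K.CrossingArcs p q o o' u u' → 0 < K.crossingDet p q →
      CrossingRel K (.gen u') (.ur (.gen u) (.gen o))
  | neg_over {p q o o' u u'} : K.CrossingArcs p q o o' u u' → K.crossingDet p q < 0 →
      CrossingRel K (.gen o') (.ll (.gen o) (.gen u))
  | neg_under {p q o o' u u'} : K.CrossingArcs p q o o' u u' → K.crossingDet p q < 0 →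
      CrossingRel K (.gen u') (.ul (.gen u) (.gen o))

/-- `BQ(K)`: one generator for each arc, two relations for each real crossing. -/
def BQ (K : VirtualKnotDiagram n) : Type := PresentedBiquandle K.CrossingRel

instance (K : VirtualKnotDiagram n) : Biquandle K.BQ :=
  inferInstanceAs (Biquandle (PresentedBiquandle K.CrossingRel))

/-- `A` is a biquandle for the diagram `K`: it is generated by elements, one for each arc, that
satisfy the relations of the crossings. -/
def IsBiquandleFor (K : VirtualKnotDiagram n) (A : Type*) [Biquandle A] : Prop :=
  ∃ g : K.Arc → A, (∀ s t, K.CrossingRel s t → s.eval g = t.eval g) ∧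
    ∀ x : A, ∃ w : BWord K.Arc, w.eval g = x

end VirtualKnotDiagram

/-! ### The vertical mirror image -/

/-- Reversal of the orientation of every circle. -/
def Circles.rev {n : ℕ} (p : Circles n) : Circles n := (p.1, -p.2)

/-- Reflection of the plane in a vertical line. -/
def planeReflect (v : ℝ × ℝ) : ℝ × ℝ := (-v.1, v.2)

theorem Circles.rev_rev {n : ℕ} (p : Circles n) : p.rev.rev = p := by
  simp [Circles.rev]

theorem Circles.rev_injective {n : ℕ} : Function.Injective (Circles.rev (n := n)) :=
  Function.LeftInverse.injective Circles.rev_rev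

theorem Circles.rev_move {n : ℕ} (p : Circles n) (s : ℝ) :
    (p.move s).rev = p.rev.move (-s) := by
  simp [Circles.rev, Circles.move, add_comm]

theorem planeReflect_injective : Function.Injective planeReflect := by
  rintro ⟨a, b⟩ ⟨c, d⟩ h
  simpa [planeReflect] using h

namespace VirtualKnotDiagram

variable {n : ℕ}

theorem velocity_reflect_rev (K : VirtualKnotDiagram n) (p : Circles n) :
    Circles.velocity (fun q => planeReflect (K.toFun q.rev)) p =
      ((Circles.velocity K.toFun p.rev).1, -(Circles.velocity K.toFun p.rev).2) := by
  have hd : HasDerivAt (fun s : ℝ => K.toFun (p.rev.move s)) (Circles.velocity K.toFun p.rev) 0 :=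
    (((K.smooth p.rev).differentiable (by simp)) 0).hasDerivAt
  have hd' : HasDerivAt (fun s : ℝ => K.toFun (p.rev.move (-s)))
      (-(Circles.velocity K.toFun p.rev)) 0 := by
    have h0 : HasDerivAt (fun s : ℝ => K.toFun (p.rev.move s))
        (Circles.velocity K.toFun p.rev) (-0) := by simpa using hd
    have h := h0.scomp (0 : ℝ) (hasDerivAt_neg (0 : ℝ))
    rw [neg_one_smul] at h
    exact h
  have h1 : HasDerivAt (fun s : ℝ => (K.toFun (p.rev.move (-s))).1)
      (-(Circles.velocity K.toFun p.rev)).1 0 :=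
    (ContinuousLinearMap.fst ℝ ℝ ℝ).hasFDerivAt.comp_hasDerivAt (0 : ℝ) hd'
  have h2 : HasDerivAt (fun s : ℝ => (K.toFun (p.rev.move (-s))).2)
      (-(Circles.velocity K.toFun p.rev)).2 0 :=
    (ContinuousLinearMap.snd ℝ ℝ ℝ).hasFDerivAt.comp_hasDerivAt (0 : ℝ) hd'
  have h3 := (h1.neg.prodMk h2).deriv
  simp only [Circles.velocity, Circles.rev_move, planeReflect] at h3 ⊢
  refine Eq.trans ?_ (h3.trans ?_)
  · rfl
  · simp

/-- The vertical mirror image of a diagram: the diagram is reflected in a vertical line of the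
plane, over strands stay over strands and virtual crossings stay virtual, and all components are
traversed backwards. So the vertical mirror image of the closure of a braid is the closure
of the inverse braid. -/
def verticalMirror (K : VirtualKnotDiagram n) : VirtualKnotDiagram n where
  toFun p := planeReflect (K.toFun p.rev)
  smooth p := by
    have h : ContDiff ℝ ∞ fun s : ℝ => K.toFun (p.rev.move (-s)) :=
      (K.smooth p.rev).comp contDiff_neg
    simp only [Circles.rev_move, planeReflect]
    exact h.fst.neg.prodMk h.snd
  immersion p h := by
    apply K.immersion p.rev
    rw [velocity_reflect_rev] at h
    simpa [Prod.ext_iff] using h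
  finite_double := by
    refine (K.finite_double.preimage (f := Prod.map Circles.rev Circles.rev)
      (Circles.rev_injective.prodMap Circles.rev_injective).injOn).subset ?_
    rintro ⟨p, q⟩ ⟨h1, h2⟩
    exact ⟨fun h => h1 (Circles.rev_injective h), planeReflect_injective h2⟩
  no_triple p q r h1 h2 h3 h4 h5 :=
    K.no_triple p.rev q.rev r.rev (Circles.rev_injective.ne h1) (Circles.rev_injective.ne h2)
      (Circles.rev_injective.ne h3) (planeReflect_injective h4) (planeReflect_injective h5)
  transverse p q h1 h2 := by
    have := K.transverse p.rev q.rev (Circles.rev_injective.ne h1) (planeReflect_injective h2)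
    rw [velocity_reflect_rev, velocity_reflect_rev]
    intro h
    apply this
    simp only [planeDet] at h ⊢
    linarith
  IsOver p q := K.IsOver p.rev q.rev
  isOver_double p q h :=
    ⟨fun e => (K.isOver_double _ _ h).1 (congrArg Circles.rev e),
      congrArg planeReflect (K.isOver_double _ _ h).2⟩
  isOver_asymm p q h := K.isOver_asymm _ _ h

end VirtualKnotDiagram

/-!
The relations `o' = o_u`, `u' = u^o` of a positive crossing say that the switch
`(o, u) ↦ (o_u, u^o)` carries `(o, u)` to `(o', u')`. By axiom (3) the barred operations define the
inverse switch, so these relations are equivalent to those of a negative crossing with the incoming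
and outgoing arcs exchanged. Passing to the vertical mirror image does exactly this at every
crossing: reversing all components exchanges incoming and outgoing arcs, reversing both strands
does not change the orientation of the frame, and the reflection changes it. Hence the bijection of
arcs given by `p ↦ p.rev` respects the crossing relations in every biquandle.
-/

open BiquandleOps

/-- A homomorphism of biquandles: a map that respects the four operations. Only the operations are
required of the two sides, so that the notion applies to formal expressions as well. -/
structure IsBiquandleHom {A B : Type*} [BiquandleOps A] [BiquandleOps B] (φ : A → B) : Prop where
  map_ur : ∀ a b, φ (ur a b) = ur (φ a) (φ b)
  map_lr : ∀ a b, φ (lr a b) = lr (φ a) (φ b)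
  map_ul : ∀ a b, φ (ul a b) = ul (φ a) (φ b)
  map_ll : ∀ a b, φ (ll a b) = ll (φ a) (φ b)

/-- The operations on formal expressions, which make evaluation a homomorphism. -/
instance BWord.instOps {α : Type*} : BiquandleOps (BWord α) := ⟨.ur, .lr, .ul, .ll⟩

theorem BWord.isBiquandleHom_eval {α A : Type*} [BiquandleOps A] (g : α → A) :
    IsBiquandleHom (BWord.eval g) :=
  ⟨fun _ _ => rfl, fun _ _ => rfl, fun _ _ => rfl, fun _ _ => rfl⟩

theorem IsBiquandleHom.map_eval {α A B : Type*} [BiquandleOps A] [BiquandleOps B] {φ : A → B}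
    (hφ : IsBiquandleHom φ) (g : α → A) (w : BWord α) : φ (w.eval g) = w.eval (φ ∘ g) := by
  induction w with
  | gen a => rfl
  | ur s t hs ht => exact (hφ.map_ur _ _).trans (congrArg₂ ur hs ht)
  | lr s t hs ht => exact (hφ.map_lr _ _).trans (congrArg₂ lr hs ht)
  | ul s t hs ht => exact (hφ.map_ul _ _).trans (congrArg₂ ul hs ht)
  | ll s t hs ht => exact (hφ.map_ll _ _).trans (congrArg₂ ll hs ht)

section Generators

variable {α β A : Type*} [BiquandleOps A]

/-- The family `g` satisfies the relations `r`. -/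
def SatisfiesRelations (r : BWord α → BWord α → Prop) (g : α → A) : Prop :=
  ∀ s t, r s t → s.eval g = t.eval g

/-- The family `g` generates `A` under the four operations. -/
def Generates (g : α → A) : Prop :=
  ∀ x, ∃ w : BWord α, w.eval g = x

theorem Generates.of_comp {f : α → β} {g : β → A} (h : Generates (g ∘ f)) : Generates g := by
  intro x
  obtain ⟨w, rfl⟩ := h x
  exact ⟨w.eval (.gen ∘ f), (BWord.isBiquandleHom_eval g).map_eval _ w⟩

theorem generates_comp_equiv_iff (e : α ≃ β) {g : β → A} : Generates (g ∘ e) ↔ Generates g := by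
  refine ⟨Generates.of_comp, fun h => Generates.of_comp (f := e.symm) ?_⟩
  rwa [Function.comp_assoc, e.self_comp_symm]

end Generators

namespace BTerm

variable {α β : Type*}

/-- Renaming of the generators of a term. -/
def map (f : α → β) : BTerm α → BTerm β
  | .gen a => .gen (f a)
  | .ur s t => .ur (s.map f) (t.map f)
  | .lr s t => .lr (s.map f) (t.map f)
  | .ul s t => .ul (s.map f) (t.map f)
  | .ll s t => .ll (s.map f) (t.map f)
  | .x1 s => .x1 (s.map f)
  | .x1v s => .x1v (s.map f)
  | .x2 s => .x2 (s.map f)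
  | .x2v s => .x2v (s.map f)
  | .x4 s t => .x4 (s.map f) (t.map f)
  | .x4v s t => .x4v (s.map f) (t.map f)

theorem leftInverse_map {f : α → β} {g : β → α} (h : Function.LeftInverse g f) :
    Function.LeftInverse (map g) (map f) := by
  intro t
  induction t <;> simp_all [map, h _]

theorem Rel.map {r : BWord α → BWord α → Prop} {r' : BWord β → BWord β → Prop} {f : α → β}
    (hf : ∀ s t, r s t → Rel r' ((s.eval gen).map f) ((t.eval gen).map f)) {a b : BTerm α}
    (hab : Rel r a b) : Rel r' (a.map f) (b.map f) := by
  induction hab with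
  | rel hst => exact hf _ _ hst
  | symm _ ih => exact ih.symm
  | trans _ _ ih ih' => exact ih.trans ih'
  | _ => grind [BTerm.map, Rel]

end BTerm

namespace PresentedBiquandle

variable {α β : Type*} {r : BWord α → BWord α → Prop} {r' : BWord β → BWord β → Prop}

/-- The element of a presented biquandle that is represented by a term. -/
def mk (r : BWord α → BWord α → Prop) (t : BTerm α) : PresentedBiquandle r :=
  Quotient.mk (BTerm.setoid r) t

/-- The generators of a presented biquandle. -/
def of (r : BWord α → BWord α → Prop) (a : α) : PresentedBiquandle r :=
  mk r (.gen a)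

theorem mk_map_eval_gen (r' : BWord β → BWord β → Prop) (f : α → β) (w : BWord α) :
    mk r' ((w.eval BTerm.gen).map f) = w.eval (of r' ∘ f) := by
  have hom : IsBiquandleHom (mk r' ∘ BTerm.map f) :=
    ⟨fun _ _ => rfl, fun _ _ => rfl, fun _ _ => rfl, fun _ _ => rfl⟩
  exact hom.map_eval BTerm.gen w

theorem satisfiesRelations_of (r : BWord α → BWord α → Prop) : SatisfiesRelations r (of r) := by
  have hom : IsBiquandleHom (mk r) :=
    ⟨fun _ _ => rfl, fun _ _ => rfl, fun _ _ => rfl, fun _ _ => rfl⟩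
  intro s t hst
  calc s.eval (of r) = mk r (s.eval BTerm.gen) := (hom.map_eval BTerm.gen s).symm
    _ = mk r (t.eval BTerm.gen) := Quotient.sound (.rel hst)
    _ = t.eval (of r) := hom.map_eval BTerm.gen t

/-- The homomorphism of presented biquandles that extends a map of the generators. It also respects
the operations that name the elements whose existence the axioms assert. -/
def map (f : α → β) (hf : SatisfiesRelations r (of r' ∘ f)) :
    PresentedBiquandle r → PresentedBiquandle r' :=
  Quotient.map (BTerm.map f) fun _ _ => BTerm.Rel.map fun s t hst => Quotient.exact <|
    (mk_map_eval_gen r' f s).trans <| (hf s t hst).trans (mk_map_eval_gen r' f t).symm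

/-- The isomorphism of presented biquandles induced by a bijection of the generators that, together
with its inverse, respects the relations. -/
def isoOfEquiv (e : α ≃ β) (h : SatisfiesRelations r (of r' ∘ e))
    (h' : SatisfiesRelations r' (of r ∘ e.symm)) :
    BiquandleIso (PresentedBiquandle r) (PresentedBiquandle r') where
  toFun := map e h
  invFun := map e.symm h'
  left_inv := by
    rintro ⟨t⟩
    exact congrArg (mk r) (BTerm.leftInverse_map e.left_inv t)
  right_inv := by
    rintro ⟨t⟩
    exact congrArg (mk r') (BTerm.leftInverse_map e.right_inv t)
  map_ur := by rintro ⟨s⟩ ⟨t⟩; rfl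
  map_lr := by rintro ⟨s⟩ ⟨t⟩; rfl
  map_ul := by rintro ⟨s⟩ ⟨t⟩; rfl
  map_ll := by rintro ⟨s⟩ ⟨t⟩; rfl

end PresentedBiquandle

namespace BiquandleOps

variable {A : Type*} [BiquandleOps A]

/-- The relations of a positive crossing, with over strand from `o` to `o'` and under strand from
`u` to `u'`. -/
def PositiveCrossing (o o' u u' : A) : Prop :=
  o' = lr o u ∧ u' = ur u o

/-- The relations of a negative crossing, with over strand from `o` to `o'` and under strand from
`u` to `u'`. -/
def NegativeCrossing (o o' u u' : A) : Prop :=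
  o' = ll o u ∧ u' = ul u o

end BiquandleOps

theorem Biquandle.positiveCrossing_iff_negativeCrossing_reverse {A : Type*} [Biquandle A]
    {o o' u u' : A} : PositiveCrossing o o' u u' ↔ NegativeCrossing o' o u' u := by
  constructor
  · rintro ⟨rfl, rfl⟩
    exact ⟨Biquandle.ax3_lr o u, Biquandle.ax3_ur u o⟩
  · rintro ⟨rfl, rfl⟩
    exact ⟨Biquandle.ax3_ll o' u', Biquandle.ax3_ul u' o'⟩

/-- The bijection of connected components induced by a homeomorphism. -/
noncomputable def connectedComponentsCongr {X Y : Type*} [TopologicalSpace X] [TopologicalSpace Y]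
    (h : X ≃ₜ Y) : ConnectedComponents X ≃ ConnectedComponents Y :=
  (h.isQuotientMap.isCoinducing.connectedComponentsHomeomorph fun y => by
    simpa [← h.image_symm] using isConnected_singleton).toEquiv

/-- Reversal of the orientation of every circle, as a homeomorphism. -/
def Circles.revHomeomorph (n : ℕ) : Circles n ≃ₜ Circles n :=
  (Homeomorph.refl (Fin n)).prodCongr (Homeomorph.neg UnitAddCircle)

namespace VirtualKnotDiagram

variable {n : ℕ} (K : VirtualKnotDiagram n)

theorem isOver_verticalMirror {p q : Circles n} :
    K.verticalMirror.IsOver p.rev q.rev ↔ K.IsOver p q := by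
  simp only [verticalMirror, Circles.rev_rev]

theorem rev_mem_realPoints_verticalMirror {p : Circles n} :
    p.rev ∈ K.verticalMirror.realPoints ↔ p ∈ K.realPoints :=
  ((Circles.revHomeomorph n).exists_congr fun _ =>
    (or_congr K.isOver_verticalMirror K.isOver_verticalMirror).symm).symm

/-- The bijection from the arcs of a diagram to those of its vertical mirror image, by reversal. -/
noncomputable def arcMirror : K.Arc ≃ K.verticalMirror.Arc :=
  connectedComponentsCongr <| (Circles.revHomeomorph n).subtype fun _ =>
    not_congr K.rev_mem_realPoints_verticalMirror.symm

/-- The point `p` is not at a real crossing and lies on the arc `a`. -/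
def OnArc (p : Circles n) (a : K.Arc) : Prop :=
  ∃ h : p ∉ K.realPoints, ConnectedComponents.mk ⟨p, h⟩ = a

theorem onArc_verticalMirror {p : Circles n} {a : K.Arc} :
    K.verticalMirror.OnArc p.rev (K.arcMirror a) ↔ K.OnArc p a := by
  have hp : p.rev ∉ K.verticalMirror.realPoints ↔ p ∉ K.realPoints :=
    not_congr K.rev_mem_realPoints_verticalMirror
  exact ⟨fun ⟨h, ha⟩ => ⟨hp.1 h, K.arcMirror.injective ha⟩,
    fun ⟨h, ha⟩ => ⟨hp.2 h, congrArg K.arcMirror ha⟩⟩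

theorem isOut_verticalMirror {p : Circles n} {a : K.Arc} :
    K.verticalMirror.IsOut p.rev (K.arcMirror a) ↔ K.IsIn p a :=
  eventually_congr <| .of_forall fun s => by
    simpa only [Circles.rev_move, neg_neg] using! K.onArc_verticalMirror (p := p.move (-s))

theorem isIn_verticalMirror {p : Circles n} {a : K.Arc} :
    K.verticalMirror.IsIn p.rev (K.arcMirror a) ↔ K.IsOut p a :=
  eventually_congr <| .of_forall fun s => by
    simpa only [Circles.rev_move] using! K.onArc_verticalMirror (p := p.move s)

theorem crossingArcs_verticalMirror {p q : Circles n} {o o' u u' : K.Arc} :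
    K.verticalMirror.CrossingArcs p.rev q.rev (K.arcMirror o') (K.arcMirror o) (K.arcMirror u')
      (K.arcMirror u) ↔ K.CrossingArcs p q o o' u u' := by
  simp only [CrossingArcs, isOver_verticalMirror, isIn_verticalMirror, isOut_verticalMirror]
  tauto

theorem velocity_verticalMirror (p : Circles n) :
    Circles.velocity K.verticalMirror.toFun p.rev =
      ((Circles.velocity K.toFun p).1, -(Circles.velocity K.toFun p).2) := by
  simpa only [Circles.rev_rev] using! K.velocity_reflect_rev p.rev

theorem crossingDet_verticalMirror (p q : Circles n) :
    K.verticalMirror.crossingDet p.rev q.rev = -K.crossingDet p q := by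
  simp only [crossingDet, velocity_verticalMirror, planeDet]
  ring

theorem satisfiesRelations_crossingRel_iff {A : Type*} [BiquandleOps A] {g : K.Arc → A} :
    SatisfiesRelations K.CrossingRel g ↔ ∀ p q o o' u u', K.CrossingArcs p q o o' u u' →
      (0 < K.crossingDet p q → PositiveCrossing (g o) (g o') (g u) (g u')) ∧
      (K.crossingDet p q < 0 → NegativeCrossing (g o) (g o') (g u) (g u')) := by
  constructor
  · intro h p q o o' u u' hc
    exact ⟨fun hd => ⟨h _ _ (.pos_over hc hd), h _ _ (.pos_under hc hd)⟩,
      fun hd => ⟨h _ _ (.neg_over hc hd), h _ _ (.neg_under hc hd)⟩⟩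
  · rintro h _ _ (⟨hc, hd⟩ | ⟨hc, hd⟩ | ⟨hc, hd⟩ | ⟨hc, hd⟩)
    · exact ((h _ _ _ _ _ _ hc).1 hd).1
    · exact ((h _ _ _ _ _ _ hc).1 hd).2
    · exact ((h _ _ _ _ _ _ hc).2 hd).1
    · exact ((h _ _ _ _ _ _ hc).2 hd).2

theorem satisfiesRelations_comp_arcMirror_iff {A : Type*} [Biquandle A]
    {g : K.verticalMirror.Arc → A} :
    SatisfiesRelations K.CrossingRel (g ∘ K.arcMirror) ↔
      SatisfiesRelations K.verticalMirror.CrossingRel g := by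
  have rev_surjective : Function.Surjective (Circles.rev (n := n)) :=
    Function.RightInverse.surjective Circles.rev_rev
  rw [K.verticalMirror.satisfiesRelations_crossingRel_iff, rev_surjective.forall₂]
  simp only [satisfiesRelations_crossingRel_iff, K.arcMirror.surjective.forall,
    crossingArcs_verticalMirror, crossingDet_verticalMirror, neg_pos, neg_lt_zero,
    Biquandle.positiveCrossing_iff_negativeCrossing_reverse, Function.comp_apply]
  exact ⟨fun h p q o' o u' u hc => (h p q o o' u u' hc).symm,
    fun h p q o o' u u' hc => (h p q o' o u' u hc).symm⟩

end VirtualKnotDiagram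

theorem corollaryC {n : ℕ} (K : VirtualKnotDiagram n) :
    Nonempty (BiquandleIso K.BQ K.verticalMirror.BQ) ∧
      ∀ (A : Type*) [Biquandle A], K.IsBiquandleFor A ↔ K.verticalMirror.IsBiquandleFor A := by
  refine ⟨⟨PresentedBiquandle.isoOfEquiv K.arcMirror ?_ ?_⟩, fun A _ => ?_⟩
  · exact K.satisfiesRelations_comp_arcMirror_iff.2 (PresentedBiquandle.satisfiesRelations_of _)
  · apply K.satisfiesRelations_comp_arcMirror_iff.1
    rw [Function.comp_assoc, K.arcMirror.symm_comp_self]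
    exact PresentedBiquandle.satisfiesRelations_of _
  · exact (K.arcMirror.arrowCongr (.refl A)).exists_congr' fun g =>
      and_congr K.satisfiesRelations_comp_arcMirror_iff (generates_comp_equiv_iff K.arcMirror)
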